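/- Let $\kappa$ be an (infinite) regular cardinal, let $\mathcal C$ be a small category which has limits of cochains of size $<\kappa$ (i.e. limits of diagrams $\lambda^{\mathrm{op}}\to\mathcal C$ for all ordinals $0<\lambda<\kappa$), but need not have pullbacks, and let $J$ be a Grothendieck topology on $\mathcal C$ such that the site $(\mathcal C,J)$ is $\kappa$-woven. Then $\mathrm{Sh}(\mathcal C,J)$ has enough $\kappa$-points: there is a small set of points $p$ of $\mathrm{Sh}(\mathcal C,J)$ whose inverse image functors $p^*:\mathrm{Sh}(\mathcal C,J)\to\mathrm{Set}$ preserve all limits of size $<\kappa$ and are jointly conservative. Here the terms are as follows. A *$\kappa$-cotree* is a poset $T$ with a greatest element (the root) in which every interval $[x,y]$ is empty or isomorphic to the dual of an ordinal $\lambda<\kappa$. Its branches are its maximal chains, and a predecessor of a node $x$ is a node $y<x$ with nothing strictly between. A *$\kappa$-cotree in $\mathcal C$* is a functor $F:T\to\mathcal C$, where $T$ is a $\kappa$-cotree all of whose branches have length $<\kappa$, such that for each $x\in T$ at limit height (i.e. $x$ is not the root and is not a predecessor of any node) $F(x)$ is the limit of the $F(y)$ with $y>x$; together with a set of minimal nodes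 of $T$ called leaves. (A minimal node which is not a leaf is regarded as a node whose family of predecessors is the empty one.) Its *multicomposite* is the presieve on $F(\mathrm{root})$ consisting of the projections $\lim_{x\in b}F(x)\to F(\mathrm{root})$, where $b$ runs over the branches that do not end in a minimal node that is not a leaf. A *$\kappa$-warp* for $(\mathcal C,J)$ is a collection $\mathcal B(C)$ of $J$-covering presieves over $C$, for each object $C$, such that: 1. for $R\in\mathcal B(C)$ and $f:D\to C$, the pullback along $f$ of the sieve generated by $R$ contains some presieve $R'\in\mathcal B(D)$; 2. every $J$-covering sieve on an object $C$ contains the multicomposite of some $\kappa$-cotree in $\mathcal C$ with root $C$ in which, for each node $x$ that is not a leaf, the arrows $F(y)\to F(x)$ from the predecessors $y$ of $x$ form a presieve in $\mathcal B(F(x))$; and conversely the multicomposite of every such $\kappa$-cotree generates a $J$-covering sieve. The site $(\mathcal C,J)$ is *$\kappa$-woven* if it has a $\kappa$-warp $\mathcal B$ such that $\mathcal B(C)$ contains at most $\kappa$ presieves for every object $C$. -/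

import Mathlib

open CategoryTheory CategoryTheory.Limits

universe u

/-- `C` has limits of cochains of size `< κ`: limits of diagrams indexed by the dual of a nonempty
ordinal `o < κ`.  (The empty cochain is excluded: no terminal object is required.) -/
def HasCochainLimits (κ : Cardinal.{u}) (C : Type u) [SmallCategory C] : Prop :=
  ∀ o : Ordinal.{u}, 0 < o → o < κ.ord → HasLimitsOfShape (o.ToType)ᵒᵖ C

/-- A poset `T` with greatest element (the root) is a `κ`-cotree if every nonempty interval
`[x, y]` is isomorphic to the dual of an ordinal `< κ`. -/
def IsCotree (κ : Cardinal.{u}) (T : Type u) [PartialOrder T] [OrderTop T] : Prop :=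
  ∀ x y : T, x ≤ y →
    ∃ o : Ordinal.{u}, o < κ.ord ∧ Nonempty (Set.Icc x y ≃o (o.ToType)ᵒᵈ)

section Restrict

variable {C : Type u} [SmallCategory C] {T : Type u} [PartialOrder T]

/-- The restriction of a diagram indexed by a poset to a subset of the poset. -/
def restrictTo (F : T ⥤ C) (s : Set T) : s ⥤ C where
  obj x := F.obj x.1
  map f := F.map (homOfLE (leOfHom f : _ ≤ _))
  map_id x := F.map_id x.1
  map_comp f g := by rw [← F.map_comp]; rfl

/-- The cone with apex `F x` over the restriction of `F` to the elements strictly above `x`. -/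
def coneAbove (F : T ⥤ C) (x : T) : Cone (restrictTo F (Set.Ioi x)) where
  pt := F.obj x
  π :=
    { app := fun y => F.map (homOfLE (le_of_lt y.2))
      naturality := by
        intro y z f
        dsimp [restrictTo]
        rw [Category.id_comp, ← F.map_comp]
        rfl }

end Restrict

/-- A `κ`-cotree in `C`: a diagram `F` in `C` indexed by a `κ`-cotree `T` whose (maximal) branches
all have length `< κ`, which is continuous: if `x` is at a limit height (it is not the root and it
is not an immediate predecessor of another node), then `F x` is the limit of the objects
above `x` in its branch.

The set `leaves` consists of minimal nodes of `T`. A node that is not in `leaves` is considered to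
be covered by its (possibly empty) family of immediate predecessors. So a minimal node which is not
in `leaves` is one over which the empty family has been grafted. -/
structure CotreeIn (κ : Cardinal.{u}) (C : Type u) [SmallCategory C] where
  T : Type u
  [partialOrder : PartialOrder T]
  [orderTop : OrderTop T]
  isCotree : IsCotree κ T
  mk_branch_lt : ∀ b : Flag T, Cardinal.mk b < κ
  F : T ⥤ C
  continuous : ∀ x : T, Order.IsPredLimit x → Nonempty (IsLimit (coneAbove F x))
  leaves : Set T
  isMin_of_mem_leaves : ∀ x ∈ leaves, IsMin x

namespace CotreeIn

attribute [instance] CotreeIn.partialOrder CotreeIn.orderTop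

variable {κ : Cardinal.{u}} {C : Type u} [SmallCategory C] (D : CotreeIn κ C)

/-- The object at the root. -/
def root : C := D.F.obj ⊤

/-- The presieve on `F x` formed by the arrows `F y ⟶ F x` from the immediate predecessors `y`
of the node `x`. -/
def predecessors (x : D.T) : Presieve (D.F.obj x) :=
  Presieve.ofArrows (fun y : {y : D.T // y ⋖ x} => D.F.obj y.1)
    (fun y => D.F.map (homOfLE y.2.le))

/-- The predecessors of each node (other than the leaves) form a presieve in `B`. -/
def IsBuiltFrom (B : ∀ X : C, Set (Presieve X)) : Prop :=
  ∀ x : D.T, x ∉ D.leaves → D.predecessors x ∈ B (D.F.obj x)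

/-- The multicomposite: the presieve over the root given by the projections to the root from
the limits of the maximal branches. A branch that ends in a minimal node which is not a leaf
(i.e. one over which the empty family has been grafted) does not contribute. -/
inductive multicomposite : Presieve D.root
  | proj (b : Flag D.T) (hb : ∀ x ∈ b, IsMin x → x ∈ D.leaves)
      (c : Cone (restrictTo D.F (b : Set D.T))) (hc : IsLimit c) :
      multicomposite (c.π.app ⟨⊤, b.top_mem⟩ : c.pt ⟶ D.F.obj ⊤)

end CotreeIn

/-- A `κ`-warp for the site `(C, J)`. -/
structure KappaWarp (κ : Cardinal.{u}) {C : Type u} [SmallCategory C]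
    (J : GrothendieckTopology C) where
  /-- The chosen presieves over each object. -/
  presieves : ∀ X : C, Set (Presieve X)
  covering : ∀ (X : C), ∀ R ∈ presieves X, Sieve.generate R ∈ J X
  /-- The pullback of a sieve generated by a presieve of the warp contains one of the warp. -/
  pullback : ∀ ⦃X Y : C⦄ (f : Y ⟶ X), ∀ R ∈ presieves X,
    ∃ R' ∈ presieves Y, R' ≤ ((Sieve.generate R).pullback f).arrows
  /-- Every covering sieve contains the multicomposite of a cotree built from the warp. -/
  exists_multicomposite : ∀ (X : C), ∀ S ∈ J X, ∃ (D : CotreeIn κ C) (h : D.root = X),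
    D.IsBuiltFrom presieves ∧ D.multicomposite ≤ (S.pullback (eqToHom h)).arrows
  /-- Multicomposites of cotrees built from the warp are covering. -/
  multicomposite_mem : ∀ D : CotreeIn κ C, D.IsBuiltFrom presieves →
    Sieve.generate D.multicomposite ∈ J D.root

/-- The site `(C, J)` is `κ`-woven: it has a `κ`-warp with at most `κ` presieves over each
object. -/
def IsWoven (κ : Cardinal.{u}) {C : Type u} [SmallCategory C]
    (J : GrothendieckTopology C) : Prop :=
  ∃ B : KappaWarp κ J, ∀ X : C, Cardinal.mk (B.presieves X) ≤ κ

/-- A `κ`-point: a point whose inverse image functor on sheaves of sets preserves limits of size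
`< κ`. -/
def IsKappaPoint (κ : Cardinal.{u}) {C : Type u} [SmallCategory C]
    {J : GrothendieckTopology C} (p : GrothendieckTopology.Point.{u} J) : Prop :=
  ∀ (K : Type u) [SmallCategory K], HasCardinalLT (Arrow K) κ →
    PreservesLimitsOfShape K (p.sheafFiber (A := Type u))

/-- `Sh(C, J)` has enough `κ`-points: there is a small set of `κ`-points whose inverse image
functors are jointly conservative. -/
def HasEnoughKappaPoints (κ : Cardinal.{u}) {C : Type u} [SmallCategory C]
    (J : GrothendieckTopology C) : Prop :=
  ∃ P : ObjectProperty (GrothendieckTopology.Point.{u} J),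
    ObjectProperty.Small.{u} P ∧ P.IsConservativeFamilyOfPoints ∧
      ∀ p : GrothendieckTopology.Point.{u} J, P p → IsKappaPoint κ p

/-! Points come from cochains `p` of length `κ`. The functor `Φ = colim_i Hom(p_i, -)` is a
`κ`-filtered colimit of representables, hence preserves the `κ`-small limits of `C`. If `p` is
generic for the warp, elements of `Φ` lift along the presieves of the warp. Descending a cotree
transfinitely, they lift along multicomposites as well (`CotreeIn.exists_lift_multicomposite`),
hence along covering sieves. So `Φ` is the fibre of a point, and a `κ`-point since its category of
elements is dually `κ`-filtered.

There are enough of these. Let `S` be a sieve on `X` along which every generic point lifts elements.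
Consider all attempts (runs) to build a generic cochain down from `X`: a successor step picks an
arrow of a prescribed presieve, a limit step takes a limit, and a run halts once its map to `X` lies
in `S`. As there are at most `κ` presieves over each object, `κ` steps suffice to treat all of them
(`exists_tasks`). A branch of unbounded height would be a generic cochain, and lifting along `S` in
its point would have halted it. So branches are shorter than `κ`, and the runs form a cotree built
from the warp (`isBuiltFrom_tree`). A branch with a limit ends in a node
(`exists_isMin_of_isLimit`), and a contributing one in a halted node. Thus `S` contains a covering
multicomposite. -/

/-! ### `κ`-filtered colimits of sets commute with `κ`-small limits. -/

theorem preservesLimitsOfShape_colim_of_isCardinalFiltered {κ : Cardinal.{u}} [Fact κ.IsRegular]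
    (A : Type u) [SmallCategory A] [IsCardinalFiltered A κ]
    (K : Type u) [SmallCategory K] (hK : HasCardinalLT (Arrow K) κ) :
    PreservesLimitsOfShape K (colim : (A ⥤ Type u) ⥤ Type u) where
  preservesLimit {F} := ⟨fun {c} hc => by
    have := isFiltered_of_isCardinalFiltered A κ
    have hK' : HasCardinalLT K κ := hasCardinalLT_of_hasCardinalLT_arrow hK
    have hev (a : A) := (Types.isLimit_iff _).1
      ⟨isLimitOfPreserves ((evaluation A (Type u)).obj a) hc⟩
    have hι (k : K) (a : A) (y : c.pt.obj a) :
        colimMap (c.π.app k) (colimit.ι c.pt a y) = colimit.ι (F.obj k) a ((c.π.app k).app a y) :=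
      ConcreteCategory.congr_hom (ι_colimMap (c.π.app k) a) y
    have hm {k k' : K} (φ : k ⟶ k') (a : A) (y : (F.obj k).obj a) :
        colimMap (F.map φ) (colimit.ι (F.obj k) a y)
          = colimit.ι (F.obj k') a ((F.map φ).app a y) :=
      ConcreteCategory.congr_hom (ι_colimMap (F.map φ) a) y
    have hw (G : A ⥤ Type u) {a a' : A} (f : a ⟶ a') (y : G.obj a) :
        colimit.ι G a' (G.map f y) = colimit.ι G a y :=
      ConcreteCategory.congr_hom (colimit.w G f) y
    have hsurj (G : A ⥤ Type u) (y : (colimit G : Type u)) :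
        ∃ (a : A) (z : G.obj a), colimit.ι G a z = y :=
      Types.jointly_surjective_of_isColimit (colimit.isColimit G) y
    have heq (G : A ⥤ Type u) {a : A} (y y' : G.obj a)
        (h : colimit.ι G a y = colimit.ι G a y') :
        ∃ (a' : A) (f : a ⟶ a'), G.map f y = G.map f y' :=
      (Types.FilteredColimit.isColimit_eq_iff' (colimit.isColimit G) _ _).1 h
    refine (Types.isLimit_iff _).2 fun s hs => ?_
    have hs' {k k' : K} (φ : k ⟶ k') : colimMap (F.map φ) (s k) = s k' := hs φ
    obtain ⟨a₀, z, hz⟩ : ∃ (a₀ : A) (z : ∀ k, (F.obj k).obj a₀),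
        ∀ k, colimit.ι (F.obj k) a₀ (z k) = s k := by
      choose a z hz using fun k => hsurj (F.obj k) (s k)
      exact ⟨IsCardinalFiltered.max a hK',
        fun k => (F.obj k).map (IsCardinalFiltered.toMax a hK' k) (z k),
        fun k => (hw _ _ _).trans (hz k)⟩
    -- One stage must witness the compatibilities for all arrows at once; this needs the bound on
    -- `Arrow K`, not only on objects.
    obtain ⟨a₁, α, hα⟩ : ∃ (a₁ : A) (α : a₀ ⟶ a₁), ∀ (φ : Arrow K),
        (F.obj φ.right).map α ((F.map φ.hom).app _ (z φ.left))
          = (F.obj φ.right).map α (z φ.right) := by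
      choose a f hf using fun φ : Arrow K => heq (F.obj φ.right)
        ((F.map φ.hom).app _ (z φ.left)) (z φ.right) (by rw [← hm, hz, hz, hs'])
      obtain ⟨m, g, b, hb⟩ := IsCardinalFiltered.wideSpan f hK
      refine ⟨m, b, fun φ => ?_⟩
      simp only [← hb φ, Functor.map_comp, types_comp_apply, hf]
    obtain ⟨x, hx, -⟩ := hev a₁ (fun k => (F.obj k).map α (z k)) (fun {k k'} φ => by
      exact (NatTrans.naturality_apply (F.map φ) α (z k)).trans (hα (Arrow.mk φ)))
    refine ⟨colimit.ι c.pt a₁ x, fun k => ?_, fun y hy => ?_⟩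
    · refine (hι k a₁ x).trans ?_
      rw [show (c.π.app k).app a₁ x = _ from hx k, hw, hz]
    · obtain ⟨a₂, y, rfl⟩ := hsurj _ y
      let a₃ := IsFiltered.max a₁ a₂
      let l : a₁ ⟶ a₃ := IsFiltered.leftToMax a₁ a₂
      let r : a₂ ⟶ a₃ := IsFiltered.rightToMax a₁ a₂
      have key (k : K) : colimit.ι (F.obj k) a₃ ((c.π.app k).app a₃ (c.pt.map r y))
          = colimit.ι (F.obj k) a₃ ((c.π.app k).app a₃ (c.pt.map l x)) := by
        rw [← hι, ← hι, hw, hw, hι k a₁, show (c.π.app k).app a₁ x = _ from hx k, hw, hz]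
        exact hy k
      choose a f hf using fun k => heq _ _ _ (key k)
      obtain ⟨m, g, b, hb⟩ := IsCardinalFiltered.wideSpan f hK'
      rw [← hw c.pt (r ≫ b), ← hw c.pt (l ≫ b)]
      congr 1
      have nat (k : K) {a a' : A} (f : a ⟶ a') (y : c.pt.obj a) :
        (c.π.app k).app a' (c.pt.map f y) = (F.obj k).map f ((c.π.app k).app a y) :=
          NatTrans.naturality_apply (c.π.app k) f y
      -- At stage `m` both elements have the same components, so uniqueness in the limit at `m`
      -- identifies them.
      obtain ⟨w, -, hu⟩ := hev m (fun k => (c.π.app k).app m (c.pt.map (l ≫ b) x))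
        (fun {k k'} φ => ConcreteCategory.congr_hom
          (NatTrans.congr_app (c.w φ) m) (c.pt.map (l ≫ b) x))
      rw [hu (c.pt.map (l ≫ b) x) fun k => rfl]
      refine hu _ fun k => ?_
      change (c.π.app k).app m (c.pt.map (r ≫ b) y) = (c.π.app k).app m (c.pt.map (l ≫ b) x)
      simp only [Functor.map_comp, types_comp_apply]
      rw [nat k b, nat k b, ← hb k, Functor.map_comp, types_comp_apply, types_comp_apply, hf]⟩

/-! ### The fibre functor of a cochain of length `κ`. -/

section

open GrothendieckTopology.Point

variable {κ : Cardinal.{u}} [Fact κ.IsRegular] {C : Type u} [SmallCategory C]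
  (p : κ.ord.ToTypeᵒᵖ ⥤ C)

instance : IsCofiltered κ.ord.ToTypeᵒᵖ :=
  have := isFiltered_of_isCardinalFiltered κ.ord.ToType κ
  inferInstance

instance : InitiallySmall.{u} κ.ord.ToTypeᵒᵖ :=
  initiallySmall_of_essentiallySmall _

instance : IsCardinalFiltered (κ.ord.ToTypeᵒᵖ)ᵒᵖ κ :=
  .of_equivalence κ (opOpEquivalence κ.ord.ToType).symm

theorem preservesLimitsOfShape_fiber (K : Type u) [SmallCategory K]
    (hK : HasCardinalLT (Arrow K) κ) :
    PreservesLimitsOfShape K (ofIsCofiltered.fiber.{u} p) := by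
  have := preservesLimitsOfShape_colim_of_isCardinalFiltered (κ := κ) (κ.ord.ToTypeᵒᵖ)ᵒᵖ K hK
  have : PreservesLimitsOfShape K (shrinkYoneda.{u} (C := C)) := by infer_instance
  unfold ofIsCofiltered.fiber
  infer_instance

/-- The sheaf fibre is a colimit over the opposite category of elements of the fibre, in which the
cochain is final; so the indexing category is `κ`-filtered. -/
theorem isKappaPoint_of_fiber_eq {J : GrothendieckTopology C}
    (x : GrothendieckTopology.Point.{u} J) (hx : x.fiber = ofIsCofiltered.fiber.{u} p) :
    IsKappaPoint κ x := by
  intro K _ hK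
  have : IsCardinalFiltered (x.fiber.Elementsᵒᵖ) κ := by
    rw [hx]
    exact .of_final (ofIsCofiltered.functor.{u} p).op κ
  have := preservesLimitsOfShape_colim_of_isCardinalFiltered (κ := κ) x.fiber.Elementsᵒᵖ K hK
  unfold sheafFiber presheafFiber
  infer_instance

end

/-! ### Limits over small posets, and the order structure of cotrees. -/

theorem hasCardinalLT_arrow_of_preorder {κ : Cardinal.{u}} (hκ : Cardinal.aleph0 ≤ κ)
    (A : Type u) [Preorder A] (hA : Cardinal.mk A < κ) : HasCardinalLT (Arrow A) κ := by
  have h := (hasCardinalLT_iff_cardinal_mk_lt A κ).2 hA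
  refine (hasCardinalLT_prod hκ h h).of_injective (fun f : Arrow A => (f.left, f.right)) ?_
  rintro ⟨a, b, f⟩ ⟨a', b', f'⟩ h
  obtain ⟨rfl, rfl⟩ : a = a' ∧ b = b' := by simpa using h
  obtain rfl := Subsingleton.elim f f'
  rfl

theorem exists_map_eq_of_isLimit {C : Type u} [SmallCategory C] (Φ : C ⥤ Type u)
    {A : Type u} [Preorder A] [PreservesLimitsOfShape A Φ] {G : A ⥤ C} {c : Cone G}
    (hc : IsLimit c) (a : ∀ t, Φ.obj (G.obj t))
    (ha : ∀ t t' (h : t ≤ t'), Φ.map (G.map (homOfLE h)) (a t) = a t') :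
    ∃ y : Φ.obj c.pt, ∀ t, Φ.map (c.π.app t) y = a t :=
  ((Types.isLimit_iff _).1 ⟨isLimitOfPreserves Φ hc⟩ a
    (fun {t t'} f => ha t t' (leOfHom f))).exists

theorem HasCochainLimits.hasLimitsOfShape {κ : Cardinal.{u}} {C : Type u} [SmallCategory C]
    (hC : HasCochainLimits κ C) (A : Type u) [LinearOrder A] [WellFoundedGT A] [Nonempty A]
    (hA : Cardinal.mk A < κ) : HasLimitsOfShape A C := by
  let o : Ordinal.{u} := Ordinal.type (fun x y : Aᵒᵈ => x < y)
  have ho : o.card = Cardinal.mk A := Ordinal.card_type _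
  have h0 : 0 < o := by
    refine pos_of_ne_zero fun h => Cardinal.mk_ne_zero A ?_
    rw [← ho, h, Ordinal.card_zero]
  have := hC o h0 (Cardinal.lt_ord.2 (ho ▸ hA))
  obtain ⟨e⟩ := Ordinal.type_eq.1 (Ordinal.type_toType o)
  let e' : o.ToType ≃o Aᵒᵈ := OrderIso.ofRelIsoLT e
  exact hasLimitsOfShape_of_equivalence
    (e'.equivalence.op.trans (orderDualEquivalence Aᵒᵈ).symm : (o.ToType)ᵒᵖ ≌ A)

namespace IsCotree

variable {κ : Cardinal.{u}} {T : Type u} [PartialOrder T] [OrderTop T] (hT : IsCotree κ T)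
include hT

theorem le_or_le {x y z : T} (hy : x ≤ y) (hz : x ≤ z) : y ≤ z ∨ z ≤ y := by
  obtain ⟨o, -, ⟨e⟩⟩ := hT x ⊤ le_top
  rcases le_total (e ⟨y, hy, le_top⟩) (e ⟨z, hz, le_top⟩) with h | h
  · exact .inl (e.le_iff_le.1 h)
  · exact .inr (e.le_iff_le.1 h)

theorem mk_Ici_lt (x : T) : Cardinal.mk (Set.Ici x) < κ := by
  obtain ⟨o, ho, ⟨e⟩⟩ := hT x ⊤ le_top
  rw [← Set.Icc_top, Cardinal.mk_congr e.toEquiv]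
  exact (Cardinal.mk_toType o).trans_lt (Cardinal.lt_ord.1 ho)

theorem exists_greatest {x : T} {s : Set T} (hx : x ∈ s) :
    ∃ z ∈ s, x ≤ z ∧ ∀ w ∈ s, x ≤ w → w ≤ z := by
  obtain ⟨o, -, ⟨e⟩⟩ := hT x ⊤ le_top
  obtain ⟨m, ⟨z, hz, rfl⟩, hm⟩ := WellFounded.has_min
    (wellFounded_lt : WellFounded fun a b : o.ToType => a < b)
    ((fun z => OrderDual.ofDual (e z)) '' {z | z.1 ∈ s}) ⟨_, ⟨x, le_rfl, le_top⟩, hx, rfl⟩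
  refine ⟨z, hz, z.2.1, fun w hw hxw => ?_⟩
  have := hm _ ⟨⟨w, hxw, le_top⟩, hw, rfl⟩
  exact e.le_iff_le.1 (not_lt.1 this)

theorem wellFoundedGT_flag (b : Flag T) : WellFoundedGT b := by
  refine ⟨WellFounded.wellFounded_iff_has_min.2 fun s ⟨x, hx⟩ => ?_⟩
  obtain ⟨z, ⟨z', hz, rfl⟩, hxz, h⟩ := hT.exists_greatest (s := Subtype.val '' s) ⟨x, hx, rfl⟩
  refine ⟨z', hz, fun w hw hlt => ?_⟩
  exact hlt.not_ge (h w ⟨w, hw, rfl⟩ (hxz.trans (le_of_lt hlt)))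

end IsCotree

/-! ### Lifting elements along multicomposites. -/

namespace CotreeIn

variable {κ : Cardinal.{u}} {C : Type u} [SmallCategory C] (D : CotreeIn κ C) (Φ : C ⥤ Type u)

/-- The order relation on the elements of the restriction of `Φ` to a cotree. -/
def ElementLE (p q : Σ t : D.T, Φ.obj (D.F.obj t)) : Prop :=
  ∃ h : p.1 ≤ q.1, Φ.map (D.F.map (homOfLE h)) p.2 = q.2

theorem map_map {x y z : D.T} (h : x ≤ y) (h' : y ≤ z) (a : Φ.obj (D.F.obj x)) :
    Φ.map (D.F.map (homOfLE h')) (Φ.map (D.F.map (homOfLE h)) a)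
      = Φ.map (D.F.map (homOfLE (h.trans h'))) a := by
  rw [← types_comp_apply, ← Functor.map_comp, ← Functor.map_comp, homOfLE_comp]

theorem ElementLE.trans {D : CotreeIn κ C} {Φ : C ⥤ Type u} {p q r}
    (h : D.ElementLE Φ p q) (h' : D.ElementLE Φ q r) : D.ElementLE Φ p r := by
  obtain ⟨h, e⟩ := h
  obtain ⟨h', e'⟩ := h'
  exact ⟨h.trans h', by rw [← D.map_map Φ h h', e, e']⟩

theorem elementLE_refl (p) : D.ElementLE Φ p p :=
  ⟨le_rfl, by simp [homOfLE_refl]⟩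

/-- If a set-valued functor preserves small limits and its elements lift along the presieves of
`B`, then they lift along the multicomposites of the cotrees built from `B`. -/
theorem exists_lift_multicomposite (hκ : Cardinal.aleph0 ≤ κ) (hC : HasCochainLimits κ C)
    (hΦ : ∀ (K : Type u) [SmallCategory K], HasCardinalLT (Arrow K) κ →
      PreservesLimitsOfShape K Φ)
    {B : ∀ X : C, Set (Presieve X)} (hD : D.IsBuiltFrom B)
    (hB : ∀ (X : C), ∀ R ∈ B X, ∀ x : Φ.obj X, ∃ (Y : C) (g : Y ⟶ X) (y : Φ.obj Y),
      R g ∧ Φ.map g y = x)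
    (x : Φ.obj D.root) :
    ∃ (Y : C) (g : Y ⟶ D.root) (y : Φ.obj Y), D.multicomposite g ∧ Φ.map g y = x := by
  -- Zorn replaces transfinite recursion: a maximal chain of elements over the tree is a lift of `x`
  -- pushed down as far as possible.
  obtain ⟨M, hM, hxM⟩ := (IsChain.singleton (r := D.ElementLE Φ) (a := ⟨⊤, x⟩)).exists_maxChain
  rw [Set.singleton_subset_iff] at hxM
  have hmem (q) (hq : ∀ p ∈ M, D.ElementLE Φ p q ∨ D.ElementLE Φ q p) : q ∈ M := by
    rw [hM.2 (hM.1.insert fun p hp _ => (hq p hp).symm) (Set.subset_insert q M)]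
    exact Set.mem_insert q M
  have htot {p q} (hp : p ∈ M) (hq : q ∈ M) : D.ElementLE Φ p q ∨ D.ElementLE Φ q p := by
    by_cases h : p = q
    · exact .inl (h ▸ D.elementLE_refl Φ p)
    · exact hM.1 hp hq h
  have hup {p q} (hp : p ∈ M) (h : D.ElementLE Φ p q) : q ∈ M := by
    refine hmem q fun r hr => ?_
    rcases htot hp hr with h' | h'
    · obtain ⟨h, e⟩ := h
      obtain ⟨h', e'⟩ := h'
      rcases D.isCotree.le_or_le h h' with k | k
      · exact .inr ⟨k, by rw [← e, ← e', D.map_map Φ h k]⟩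
      · exact .inl ⟨k, by rw [← e, ← e', D.map_map Φ h' k]⟩
    · exact .inl (h'.trans h)
  have huniq {t} {a a'} (h : (⟨t, a⟩ : Σ t : D.T, Φ.obj (D.F.obj t)) ∈ M)
      (h' : (⟨t, a'⟩ : Σ t : D.T, Φ.obj (D.F.obj t)) ∈ M) : a = a' := by
    rcases htot h h' with ⟨k, e⟩ | ⟨k, e⟩
    · simpa [homOfLE_refl] using e
    · simpa [homOfLE_refl] using e.symm
  let b : Set D.T := Sigma.fst '' M
  have hb_up {t t'} (ht : t ∈ b) (h : t ≤ t') : t' ∈ b := by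
    obtain ⟨p, hp, rfl⟩ := ht
    exact ⟨⟨t', Φ.map (D.F.map (homOfLE h)) p.2⟩, hup hp ⟨h, rfl⟩, rfl⟩
  have hb_chain {t t'} (ht : t ∈ b) (ht' : t' ∈ b) : t ≤ t' ∨ t' ≤ t := by
    obtain ⟨p, hp, rfl⟩ := ht
    obtain ⟨q, hq, rfl⟩ := ht'
    exact (htot hp hq).imp (·.1) (·.1)
  -- Below a node that is not a leaf the element would lift to a predecessor, contradicting
  -- maximality of `M`.
  have hmin {t} (ht : t ∈ b) (h : ∀ t' ∈ b, t ≤ t') : t ∈ D.leaves := by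
    by_contra hl
    obtain ⟨⟨t, a⟩, hp, rfl⟩ := ht
    obtain ⟨Y, g, y, ⟨⟨t', ht'⟩⟩, hy⟩ := hB _ _ (hD t hl) a
    refine ht'.lt.not_ge (h t' ⟨⟨t', y⟩, hmem _ fun q hq => .inr ?_, rfl⟩)
    refine ElementLE.trans (q := ⟨t, a⟩) ⟨ht'.le, hy⟩ ?_
    rcases htot hp hq with h' | h'
    · exact h'
    · obtain ⟨q, a'⟩ := q
      obtain rfl : q = t := le_antisymm h'.1 (h q ⟨_, hq, rfl⟩)
      rw [huniq hq hp]
      exact D.elementLE_refl Φ _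
  choose a ha using fun t : b => (show ∃ a, ⟨t.1, a⟩ ∈ M by
    obtain ⟨t, p, hp, rfl⟩ := t
    exact ⟨p.2, hp⟩)
  -- The set `w` is kept apart from `b` because this is applied both to `Set.Ioi z` and to the
  -- carrier of the flag `b'`.
  have hlim (w : Set D.T) (hw : w = b) (hcard : Cardinal.mk w < κ)
      (c : Cone (restrictTo D.F w)) (hc : IsLimit c) :
      ∃ y : Φ.obj c.pt, ∀ t : w, ∃ a, Φ.map (c.π.app t) y = a ∧ ⟨t.1, a⟩ ∈ M := by
    subst hw
    have := hΦ b (hasCardinalLT_arrow_of_preorder hκ _ hcard)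
    obtain ⟨y, hy⟩ := exists_map_eq_of_isLimit Φ hc a fun t t' h =>
      huniq (hup (ha t) ⟨h, rfl⟩) (ha t')
    exact ⟨y, fun t => ⟨_, hy t, ha t⟩⟩
  let b' : Flag D.T :=
    { carrier := b
      Chain' := fun t ht t' ht' _ => hb_chain ht ht'
      max_chain' := by
        intro s hs hbs
        refine hbs.antisymm fun y hy => ?_
        by_contra hyb
        -- If `b` were not a maximal chain, this `z` would be the first node missed. It is at limit
        -- height, since a node just above it would be the least of `b`, hence a leaf; continuity
        -- then yields an element over `z` extending `M`.
        obtain ⟨z, hz, hyz, hzmax⟩ := D.isCotree.exists_greatest (s := bᶜ) hyb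
        have hIoi : Set.Ioi z = b := by
          ext w
          refine ⟨fun hw => ?_, fun hw => ?_⟩
          · by_contra hwb
            exact (hzmax w hwb (hyz.trans (le_of_lt hw))).not_gt hw
          · have hyw : y ≤ w := by
              by_cases h : y = w
              · exact h.le
              · exact (hs hy (hbs hw) h).resolve_right fun h => hyb (hb_up hw h)
            refine lt_of_le_of_ne ((D.isCotree.le_or_le hyz hyw).resolve_right
              fun h => hz (hb_up hw h)) ?_
            rintro rfl
            exact hz hw
        have htop : (⊤ : D.T) ∈ b := ⟨_, hxM, rfl⟩
        have hpl : Order.IsPredLimit z := by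
          refine ⟨fun h => hz (h.eq_top ▸ htop), fun w hw => ?_⟩
          have := D.isMin_of_mem_leaves w (hmin (hIoi ▸ hw.lt) fun t ht => by
            rw [← hIoi] at ht
            rcases D.isCotree.le_or_le hw.le ht.le with h | h
            · exact h
            · exact (eq_or_lt_of_le h).elim (fun h => h.ge) fun h => (hw.2 ht h).elim)
          exact this.not_lt hw.lt
        obtain ⟨hc⟩ := D.continuous z hpl
        obtain ⟨a, ha⟩ := hlim _ hIoi
          ((Cardinal.mk_le_mk_of_subset Set.Ioi_subset_Ici_self).trans_lt
            (D.isCotree.mk_Ici_lt z)) _ hc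
        refine hz ⟨⟨z, a⟩, hmem _ fun q hq => .inr ?_, rfl⟩
        have hq' : q.1 ∈ Set.Ioi z := hIoi ▸ ⟨q, hq, rfl⟩
        obtain ⟨a', ha', h⟩ := ha ⟨q.1, hq'⟩
        exact ⟨le_of_lt hq', ha'.trans (huniq h hq)⟩ }
  have hlt : Cardinal.mk (b' : Set D.T) < κ := D.mk_branch_lt b'
  have hwf : WellFoundedGT (b' : Set D.T) := D.isCotree.wellFoundedGT_flag b'
  have : Nonempty (b' : Set D.T) := ⟨⟨_, b'.top_mem⟩⟩
  let _ : LinearOrder (b' : Set D.T) :=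
    { (inferInstance : PartialOrder (b' : Set D.T)) with
      le_total := fun t t' => hb_chain t.2 t'.2
      toDecidableLE := Classical.decRel _ }
  have := HasCochainLimits.hasLimitsOfShape hC (b' : Set D.T) hlt
  obtain ⟨y, hy⟩ := hlim _ rfl hlt _ (limit.isLimit (restrictTo D.F (b' : Set D.T)))
  obtain ⟨a', ha', h⟩ := hy ⟨⊤, b'.top_mem⟩
  refine ⟨_, _, y, multicomposite.proj b' (fun t ht hm => hmin ht fun t' ht' => ?_) _
    (limit.isLimit _), ha'.trans (huniq h hxM)⟩
  rcases hb_chain ht ht' with h | h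
  · exact h
  · exact hm h

end CotreeIn

/-! ### Generic cochains and their points. -/

/-- A cochain in `C` is generic for `B` if each presieve of `B` over one of its objects contains
a factor of a later transition map. -/
def IsGeneric {C : Type u} [SmallCategory C] (B : ∀ X : C, Set (Presieve X))
    {I : Type u} [Preorder I] (p : Iᵒᵖ ⥤ C) : Prop :=
  ∀ (i : I), ∀ R ∈ B (p.obj (.op i)), ∃ (j : I) (h : i ≤ j),
    Sieve.generate R (p.map (homOfLE h).op)

section

open GrothendieckTopology.Point

variable {κ : Cardinal.{u}} {C : Type u} [SmallCategory C]

/-- An element is represented by some `f : p_i ⟶ X`. Genericity applies to a presieve over `p_i`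
refining the pullback of `R` along `f`, so at a later stage `f` factors through `R`. -/
theorem IsGeneric.exists_lift [Fact κ.IsRegular] {B : ∀ X : C, Set (Presieve X)}
    {p : κ.ord.ToTypeᵒᵖ ⥤ C}
    (hp : IsGeneric B p)
    (hB : ∀ ⦃X Y : C⦄ (f : Y ⟶ X), ∀ R ∈ B X,
      ∃ R' ∈ B Y, R' ≤ ((Sieve.generate R).pullback f).arrows)
    (X : C) (R : Presieve X) (hR : R ∈ B X) (x : (ofIsCofiltered.fiber.{u} p).obj X) :
    ∃ (Y : C) (g : Y ⟶ X) (y : (ofIsCofiltered.fiber.{u} p).obj Y),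
      R g ∧ (ofIsCofiltered.fiber.{u} p).map g y = x := by
  obtain ⟨⟨i⟩, f, rfl⟩ := ofIsCofiltered.fiberMk_jointly_surjective x
  obtain ⟨R', hR', hle⟩ := hB f R hR
  obtain ⟨j, hij, Y, a, b, hb, hab⟩ := hp i R' hR'
  obtain ⟨Z, a', b', hb', hab'⟩ := hle _ _ hb
  refine ⟨Z, b', ofIsCofiltered.fiberMk (U := .op j) (a ≫ a'), hb', ?_⟩
  rw [ofIsCofiltered.fiber_map_fiberMk, Category.assoc, hab', reassoc_of% hab]
  exact ofIsCofiltered.fiberMk_map_comp (p := p) _ _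

/-- The point given by a generic cochain. -/
noncomputable def IsGeneric.point [hκ : Fact κ.IsRegular] {J : GrothendieckTopology C}
    {B : KappaWarp κ J}
    (hC : HasCochainLimits κ C) {p : κ.ord.ToTypeᵒᵖ ⥤ C} (hp : IsGeneric B.presieves p) :
    GrothendieckTopology.Point.{u} J where
  fiber := ofIsCofiltered.fiber.{u} p
  jointly_surjective {X} R hR x := by
    obtain ⟨D, rfl, hD, hle⟩ := B.exists_multicomposite X R hR
    obtain ⟨Y, g, y, hg, hy⟩ := D.exists_lift_multicomposite (ofIsCofiltered.fiber.{u} p)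
      hκ.out.aleph0_le hC (preservesLimitsOfShape_fiber p) hD (hp.exists_lift B.pullback) x
    exact ⟨Y, g, by simpa using hle _ _ hg, y, hy⟩

end

/-! ### Runs and their extension order. -/

/-- A cochain in `C` of successor length, indexed by the elements of `I` up to `ht`. -/
structure Run (C : Type u) [SmallCategory C] (I : Type u) [LinearOrder I] where
  ht : I
  diagram : Set.Iic ht ⥤ Cᵒᵖ

namespace Run

variable {C : Type u} [SmallCategory C] {I : Type u} [LinearOrder I]

/-- The truncation of a run. -/
def res (x : Run C I) (i : I) (h : i ≤ x.ht) : Run C I where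
  ht := i
  diagram := (Monotone.functor (f := fun j : Set.Iic i => (⟨j.1, le_trans j.2 h⟩ : Set.Iic x.ht))
    (fun _ _ h => h)) ⋙ x.diagram

theorem res_self (x : Run C I) : x.res x.ht le_rfl = x := rfl

/-- Runs are ordered by reverse extension. -/
instance : PartialOrder (Run C I) where
  le x y := ∃ h : y.ht ≤ x.ht, x.res y.ht h = y
  le_refl x := ⟨le_rfl, x.res_self⟩
  le_trans := by
    rintro x y z ⟨h, e⟩ ⟨h', e'⟩
    refine ⟨h'.trans h, ?_⟩
    obtain ⟨i, h₀, rfl⟩ : ∃ i, ∃ h : i ≤ x.ht, y = x.res i h := ⟨_, h, e.symm⟩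
    exact e'
  le_antisymm := by
    rintro x y ⟨h, e⟩ ⟨h', -⟩
    have : y.ht = x.ht := le_antisymm h h'
    rw [← e]
    clear e
    obtain ⟨i, F⟩ := y
    subst this
    rfl

theorem res_eq_of_le {x y : Run C I} (h : x ≤ y) {i : I} (hi : i = y.ht) :
    x.res i (hi.trans_le h.1) = y := by
  subst hi
  exact h.2

theorem le_res (x : Run C I) {i : I} (h : i ≤ x.ht) : x ≤ x.res i h := ⟨h, rfl⟩

theorem exists_eq_res {x y : Run C I} (h : x ≤ y) : ∃ i, ∃ h : i ≤ x.ht, y = x.res i h :=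
  ⟨_, h.1, h.2.symm⟩

theorem le_of_le_of_ht_le {x y z : Run C I} (hy : x ≤ y) (hz : x ≤ z) (h : z.ht ≤ y.ht) :
    y ≤ z := by
  refine ⟨h, ?_⟩
  obtain ⟨i, hi, rfl⟩ := exists_eq_res hy
  exact hz.2

theorem ht_lt {x y : Run C I} (h : x < y) : y.ht < x.ht :=
  lt_of_le_of_ne h.le.1 fun e => h.not_ge (le_of_le_of_ht_le h.le le_rfl e.ge)

theorem eq_of_le_of_ht_eq {x y : Run C I} (h : x ≤ y) (e : x.ht = y.ht) : x = y :=
  h.eq_of_not_lt fun h' => (ht_lt h').ne' e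

theorem lt_res (x : Run C I) {i : I} (h : i < x.ht) : x < x.res i h.le :=
  lt_of_le_of_ne (x.le_res h.le) fun e => h.ne (congrArg ht e).symm

/-- The last object of a run. -/
def last (x : Run C I) : C := (x.diagram.obj ⟨x.ht, le_rfl⟩).unop

/-- The functor sending a run to its last object. -/
def lastFunctor (C : Type u) [SmallCategory C] (I : Type u) [LinearOrder I] : Run C I ⥤ C where
  obj := last
  map {x y} f := (x.diagram.map (homOfLE (leOfHom f).1 :
    (⟨y.ht, (leOfHom f).1⟩ : Set.Iic x.ht) ⟶ ⟨x.ht, le_rfl⟩)).unop ≫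
      eqToHom (congrArg last (leOfHom f).2)
  map_id x := by
    simp [homOfLE_refl, last]
  map_comp {x y z} f g := by
    obtain ⟨i, h, rfl⟩ := exists_eq_res (leOfHom f)
    obtain ⟨j, h', rfl⟩ := exists_eq_res (leOfHom g)
    have key : x.diagram.map (homOfLE (h'.trans h) :
        (⟨j, le_trans h' h⟩ : Set.Iic x.ht) ⟶ ⟨x.ht, le_rfl⟩) =
        x.diagram.map (homOfLE h' : (⟨j, le_trans h' h⟩ : Set.Iic x.ht) ⟶ ⟨i, h⟩) ≫
          x.diagram.map (homOfLE h : (⟨i, h⟩ : Set.Iic x.ht) ⟶ ⟨x.ht, le_rfl⟩) := by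
      rw [← Functor.map_comp]
      rfl
    exact (Category.comp_id _).trans ((congrArg Quiver.Hom.unop key).trans
      (congrArg₂ (· ≫ ·) (Category.comp_id _).symm (Category.comp_id _).symm))

theorem lastFunctor_map_res (x : Run C I) {i : I} (h : i ≤ x.ht) :
    (lastFunctor C I).map (homOfLE (x.le_res h)) = (x.diagram.map (homOfLE h :
      (⟨i, h⟩ : Set.Iic x.ht) ⟶ ⟨x.ht, le_rfl⟩)).unop :=
  Category.comp_id _

theorem ext_of_arrow {x y : Run C I} (h : x.ht = y.ht)
    (H : ∀ (j k : I) (hjk : j ≤ k) (hk : k ≤ x.ht),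
      Arrow.mk (x.diagram.map (homOfLE hjk :
        (⟨j, hjk.trans hk⟩ : Set.Iic x.ht) ⟶ ⟨k, hk⟩)) =
      Arrow.mk (y.diagram.map (homOfLE hjk :
        (⟨j, hjk.trans (hk.trans h.le)⟩ : Set.Iic y.ht) ⟶ ⟨k, hk.trans h.le⟩))) : x = y := by
  obtain ⟨i, F⟩ := x
  obtain ⟨i', F'⟩ := y
  obtain rfl : i = i' := h
  congr 1
  exact Arrow.functor_ext fun {j k} f => H j.1 k.1 (leOfHom f) k.2

/-- Stated in the arrow category, so that transition maps can be compared although their endpoints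
agree only propositionally. -/
theorem arrow_lastFunctor_map {x y z : Run C I} (h : x ≤ y) (h' : y ≤ z) {j k : I}
    (hj : j = z.ht) (hk : k = y.ht) :
    Arrow.mk ((lastFunctor C I).map (homOfLE h')).op =
      Arrow.mk (x.diagram.map (homOfLE (hj.trans_le (h'.1.trans hk.ge)) :
        (⟨j, hj.trans_le (h'.1.trans h.1)⟩ : Set.Iic x.ht) ⟶ ⟨k, hk.trans_le h.1⟩)) := by
  subst hj hk
  obtain ⟨i, hi, rfl⟩ := exists_eq_res h
  obtain ⟨j, hj, rfl⟩ := exists_eq_res h'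
  rw [lastFunctor_map_res]
  rfl

/-- A coherent family of runs of all heights below `l` together with a cone over their last
objects defines a run of height `l`. -/
theorem exists_extension (l : I) (b : ∀ i, i < l → Run C I) (hb : ∀ i hi, (b i hi).ht = i)
    (hb' : ∀ i j hi hj, i ≤ j → b j hj ≤ b i hi) (Y : C)
    (s : ∀ i hi, Y ⟶ (lastFunctor C I).obj (b i hi))
    (hs : ∀ i j hi hj (h : i ≤ j),
      s j hj ≫ (lastFunctor C I).map (homOfLE (hb' i j hi hj h)) = s i hi) :
    ∃ (x : Run C I) (_ : x.ht = l) (hle : ∀ i hi, x ≤ b i hi)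
      (e : (lastFunctor C I).obj x = Y), ∀ i hi,
        (lastFunctor C I).map (homOfLE (hle i hi)) = eqToHom e ≫ s i hi := by
  let G : Set.Iio l ⥤ Cᵒᵖ :=
    { obj i := .op ((lastFunctor C I).obj (b i.1 i.2))
      map {i j} f := ((lastFunctor C I).map (homOfLE (hb' _ _ i.2 j.2 (leOfHom f)))).op
      map_id i := by simp [homOfLE_refl]
      map_comp f g := by rw [← op_comp, ← Functor.map_comp, homOfLE_comp] }
  let c : Cocone G :=
    { pt := .op Y
      ι :=
        { app i := (s i.1 i.2).op
          naturality i j f := by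
            exact (congrArg Quiver.Hom.op (hs _ _ i.2 j.2 (leOfHom f))).trans
              (Category.comp_id _).symm } }
  let x : Run C I := ⟨l, SmallObject.SuccStruct.ofCocone c⟩
  have hres (i : I) (hi : i < l) : x.res i hi.le = b i hi := by
    refine ext_of_arrow (hb i hi).symm fun j k hjk hk => ?_
    rw [← arrow_lastFunctor_map (hb' k i (lt_of_le_of_lt hk hi) hi hk)
      (hb' j k (lt_of_le_of_lt (hjk.trans hk) hi) (lt_of_le_of_lt hk hi) hjk)
      (hb _ _).symm (hb _ _).symm]
    exact SmallObject.SuccStruct.arrowMap_ofCocone c j k hjk (lt_of_le_of_lt hk hi)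
  have hle (i : I) (hi : i < l) : x ≤ b i hi := hres i hi ▸ x.le_res hi.le
  refine ⟨x, rfl, hle, congrArg Opposite.unop (SmallObject.SuccStruct.ofCocone_obj_eq_pt c),
    fun i hi => ?_⟩
  have h := (arrow_lastFunctor_map le_rfl (hle i hi) (hb i hi).symm rfl).trans
    (SmallObject.SuccStruct.arrowMap_ofCocone_to_top c i hi)
  obtain ⟨h₁, h₂, h⟩ := (Arrow.mk_eq_mk_iff _ _).1 h
  apply Quiver.Hom.op_inj
  rw [h]
  simp [c]

end Run

/-! ### Bookkeeping of tasks. -/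

/-- A bijection of `κ` with `(κ × κ) × κ` lists each pair `κ` times, and fewer than `κ` of these
occurrences lie below `i`. -/
theorem exists_bookkeeping {κ : Cardinal.{u}} (hκ : Cardinal.aleph0 ≤ κ) :
    ∃ φ : κ.ord.ToType → κ.ord.ToType × κ.ord.ToType, ∀ i k, ∃ j, i ≤ j ∧ φ j = (i, k) := by
  have h : Cardinal.mk κ.ord.ToType =
      Cardinal.mk ((κ.ord.ToType × κ.ord.ToType) × κ.ord.ToType) := by
    simp [Cardinal.mul_eq_self hκ]
  obtain ⟨e⟩ := Cardinal.eq.1 h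
  refine ⟨fun j => (e j).1, fun i k => ?_⟩
  by_contra! hlt
  have : Function.Injective
      (fun d => (⟨e.symm ((i, k), d), not_le.1 fun h => hlt _ h (by simp)⟩ : Set.Iio i)) := by
    intro d d' h
    simpa using congrArg Subtype.val h
  exact (Cardinal.mk_le_of_injective this).not_gt (Cardinal.mk_Iio_lt i (by simp))

theorem Cardinal.mk_Iic_toType_ord_lt {κ : Cardinal.{u}} (hκ : Cardinal.aleph0 ≤ κ)
    (i : κ.ord.ToType) : Cardinal.mk (Set.Iic i) < κ := by
  rw [← Set.Iio_insert]
  exact (Cardinal.mk_insert_le).trans_lt (Cardinal.add_lt_of_lt hκ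
    (by simpa using Cardinal.mk_Iio_lt i (by simp)) (Cardinal.one_lt_aleph0.trans_le hκ))

namespace Run

section Order

variable {C : Type u} [SmallCategory C] {I : Type u} [LinearOrder I] [SuccOrder I] [NoMaxOrder I]

theorem covBy_of_le {x y : Run C I} (h : x ≤ y) (h' : x.ht = Order.succ y.ht) : x ⋖ y := by
  refine ⟨lt_of_le_of_ne h ?_, fun z hxz hzy => ?_⟩
  · rintro rfl
    exact (Order.lt_succ x.ht).ne h'
  · have h₁ := ht_lt hxz
    rw [h', Order.lt_succ_iff] at h₁
    exact h₁.not_gt (ht_lt hzy)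

theorem exists_covBy_of_lt {x y : Run C I} (h : x < y) : ∃ z, x ≤ z ∧ z ⋖ y :=
  have h' := Order.succ_le_of_lt (ht_lt h)
  ⟨x.res _ h', x.le_res h', covBy_of_le
    (le_of_le_of_ht_le (x.le_res h') h.le (Order.le_succ _)) rfl⟩

theorem ht_eq_of_covBy {x y : Run C I} (h : x ⋖ y) : x.ht = Order.succ y.ht := by
  obtain ⟨z, hz, hzy⟩ := exists_covBy_of_lt h.lt
  have h' := Order.succ_le_of_lt (ht_lt h.lt)
  refine le_antisymm (not_lt.1 fun hlt => h.2 (x.lt_res hlt) ?_) h'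
  exact (covBy_of_le (le_of_le_of_ht_le (x.le_res h') h.le (Order.le_succ _)) rfl).lt

end Order

variable {C : Type u} [SmallCategory C]

/-- The bookkeeping: presieves over the last objects of all the runs, such that each presieve of
`B` over an object of a run is refined at some later stage. -/
theorem exists_tasks {κ : Cardinal.{u}} (hκ : Cardinal.aleph0 ≤ κ) (B : ∀ X : C, Set (Presieve X))
    (hB : ∀ ⦃X Y : C⦄ (f : Y ⟶ X), ∀ R ∈ B X,
      ∃ R' ∈ B Y, R' ≤ ((Sieve.generate R).pullback f).arrows)
    (hcard : ∀ X : C, Cardinal.mk (B X) ≤ κ) :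
    ∃ task : ∀ z : Run C κ.ord.ToType, Presieve ((lastFunctor C _).obj z),
      (∀ z, (B ((lastFunctor C _).obj z)).Nonempty → task z ∈ B _) ∧
      ∀ (y : Run C κ.ord.ToType), ∀ R ∈ B ((lastFunctor C _).obj y), ∃ j, y.ht ≤ j ∧
        ∀ (z : Run C κ.ord.ToType) (h : z ≤ y), z.ht = j →
          task z ≤ ((Sieve.generate R).pullback ((lastFunctor C _).map (homOfLE h))).arrows := by
  obtain ⟨φ, hφ⟩ := exists_bookkeeping hκ
  have henum (X : C) : ∃ e : κ.ord.ToType → Presieve X, ∀ R ∈ B X, ∃ k, e k = R := by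
    obtain ⟨f⟩ : Nonempty (B X ↪ κ.ord.ToType) := by
      rw [← Cardinal.le_def]
      simpa using hcard X
    exact ⟨Function.extend f Subtype.val (fun _ => ⊥),
      fun R hR => ⟨f ⟨R, hR⟩, f.injective.extend_apply _ _ _⟩⟩
  choose e he using henum
  have htask (z : Run C κ.ord.ToType) : ∃ t : Presieve ((lastFunctor C _).obj z),
      ((B ((lastFunctor C _).obj z)).Nonempty → t ∈ B _) ∧
      ∀ i k, φ z.ht = (i, k) → ∀ h : i ≤ z.ht, e ((lastFunctor C _).obj (z.res i h)) k ∈ B _ →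
        t ≤ ((Sieve.generate (e _ k)).pullback
          ((lastFunctor C _).map (homOfLE (z.le_res h)))).arrows := by
    -- At height `j` with `φ j = (i, k)`, the task refines the pullback of the `k`-th presieve over
    -- the object at height `i`. If that is meaningless, any presieve of `B` serves.
    by_cases h : ∃ h : (φ z.ht).1 ≤ z.ht, e ((lastFunctor C _).obj (z.res _ h)) (φ z.ht).2 ∈ B _
    · obtain ⟨h, hm⟩ := h
      obtain ⟨t, ht, ht'⟩ := hB ((lastFunctor C _).map (homOfLE (z.le_res h))) _ hm
      refine ⟨t, fun _ => ht, fun i k hik h₁ _ => ?_⟩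
      obtain rfl : (φ z.ht).1 = i := congrArg Prod.fst hik
      obtain rfl : (φ z.ht).2 = k := congrArg Prod.snd hik
      exact ht'
    · by_cases h' : (B ((lastFunctor C _).obj z)).Nonempty
      · refine ⟨h'.some, fun _ => h'.some_mem, fun i k hik h₁ h₂ => (h ?_).elim⟩
        rw [hik]
        exact ⟨h₁, h₂⟩
      · refine ⟨⊥, fun h => (h' h).elim, fun i k hik h₁ h₂ => (h ?_).elim⟩
        rw [hik]
        exact ⟨h₁, h₂⟩
  choose task ht ht' using htask
  refine ⟨task, ht, fun y R hR => ?_⟩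
  obtain ⟨k, rfl⟩ := he _ _ hR
  obtain ⟨j, hj, hjk⟩ := hφ y.ht k
  refine ⟨j, hj, fun z h hz => ?_⟩
  obtain ⟨i, hi, rfl⟩ := exists_eq_res h
  exact ht' z i k (hz ▸ hjk) hi hR

/-! ### The cotree of valid runs. -/

section Valid

variable {I : Type u} [LinearOrder I]

/-- The last object of a run is the limit of the last objects of its proper truncations. -/
def IsLimiting (x : Run C I) : Prop :=
  ∀ (Y : C) (s : ∀ z, x < z → (Y ⟶ (lastFunctor C I).obj z)),
    (∀ z w (hz : x < z) (hzw : z ≤ w),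
      s z hz ≫ (lastFunctor C I).map (homOfLE hzw) = s w (hz.trans_le hzw)) →
    ∃! l : Y ⟶ (lastFunctor C I).obj x,
      ∀ z hz, l ≫ (lastFunctor C I).map (homOfLE (le_of_lt hz)) = s z hz

/-- A run extending `r` is valid if its transition maps at successor steps belong to `task`, its
objects at limit steps are limits, and its proper truncations do not satisfy `halt`. -/
structure IsValid (r : Run C I) (task : ∀ z : Run C I, Presieve ((lastFunctor C I).obj z))
    (halt : Run C I → Prop) (x : Run C I) : Prop where
  le_root : x ≤ r
  not_halt : ∀ y z, x ≤ y → y ⋖ z → ¬ halt z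
  mem_task : ∀ y z, x ≤ y → ∀ h : y ⋖ z, task z ((lastFunctor C I).map (homOfLE h.le))
  isLimiting : ∀ y, x ≤ y → Order.IsPredLimit y → IsLimiting y

variable {r : Run C I} {task : ∀ z : Run C I, Presieve ((lastFunctor C I).obj z)}
  {halt : Run C I → Prop}

theorem isMax_of_isBot_ht (hr : IsBot r.ht) : IsMax r := fun _ h =>
  (eq_of_le_of_ht_eq h (le_antisymm (hr _) h.1)).ge

theorem isValid_root (hr : IsBot r.ht) : IsValid r task halt r where
  le_root := le_rfl
  not_halt _ _ h h' := ((isMax_of_isBot_ht hr).mono h).not_lt h'.lt |>.elim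
  mem_task _ _ h h' := ((isMax_of_isBot_ht hr).mono h).not_lt h'.lt |>.elim
  isLimiting _ h h' := (h'.1 ((isMax_of_isBot_ht hr).mono h)).elim

theorem IsValid.of_le (hr : IsBot r.ht) {x y : Run C I} (hx : IsValid r task halt x)
    (h : x ≤ y) : IsValid r task halt y where
  le_root := le_of_le_of_ht_le h hx.le_root (hr _)
  not_halt y' z h' := hx.not_halt y' z (h.trans h')
  mem_task y' z h' := hx.mem_task y' z (h.trans h')
  isLimiting y' h' := hx.isLimiting y' (h.trans h')

/-- Valid runs are closed under truncation, so no run strictly between two of them is lost. -/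
theorem IsValid.covBy_iff (hr : IsBot r.ht) (x y : {x : Run C I // IsValid r task halt x}) :
    x ⋖ y ↔ x.1 ⋖ y.1 :=
  ⟨fun h => ⟨h.lt, fun _ h₁ h₂ => h.2 (c := ⟨_, x.2.of_le hr h₁.le⟩) h₁ h₂⟩,
    fun h => ⟨h.lt, fun _ h₁ h₂ => h.2 h₁ h₂⟩⟩

end Valid

section Tree

variable {κ : Cardinal.{u}} {r : Run C κ.ord.ToType}
  {task : ∀ z : Run C κ.ord.ToType, Presieve ((lastFunctor C _).obj z)}
  {halt : Run C κ.ord.ToType → Prop}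

/-- The poset of valid runs. -/
abbrev ValidRun (r : Run C κ.ord.ToType)
    (task : ∀ z : Run C κ.ord.ToType, Presieve ((lastFunctor C _).obj z))
    (halt : Run C κ.ord.ToType → Prop) : Type u :=
  {x : Run C κ.ord.ToType // IsValid r task halt x}

theorem isCotree (hκ : Cardinal.aleph0 ≤ κ) (hr : IsBot r.ht)
    [OrderTop (ValidRun r task halt)] :
    IsCotree κ (ValidRun r task halt) := by
  intro x y hxy
  let e : Set.Icc x y ≃o (Set.Icc y.1.ht x.1.ht)ᵒᵈ :=
    { toFun w := OrderDual.toDual ⟨w.1.1.ht, (show w.1.1 ≤ y.1 from w.2.2).1,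
        (show x.1 ≤ w.1.1 from w.2.1).1⟩
      invFun i := ⟨⟨x.1.res (OrderDual.ofDual i).1 (OrderDual.ofDual i).2.2,
        x.2.of_le hr (x.1.le_res (OrderDual.ofDual i).2.2)⟩, x.1.le_res (OrderDual.ofDual i).2.2,
        le_of_le_of_ht_le (x.1.le_res (OrderDual.ofDual i).2.2) hxy (OrderDual.ofDual i).2.1⟩
      left_inv w := Subtype.ext (Subtype.ext (res_eq_of_le w.2.1 rfl))
      right_inv i := rfl
      map_rel_iff' {w w'} := ⟨fun h => le_of_le_of_ht_le w.2.1 w'.2.1 h,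
        fun h => (show w.1.1 ≤ w'.1.1 from h).1⟩ }
  let o : Ordinal.{u} := Ordinal.type (fun i j : Set.Icc y.1.ht x.1.ht => i < j)
  obtain ⟨e'⟩ := Ordinal.type_eq.1 (Ordinal.type_toType o)
  refine ⟨o, Cardinal.lt_ord.2 ?_, ⟨e.trans (OrderIso.ofRelIsoLT e').symm.dual⟩⟩
  rw [Ordinal.card_type]
  exact (Cardinal.mk_le_mk_of_subset Set.Icc_subset_Iic_self).trans_lt
    (Cardinal.mk_Iic_toType_ord_lt hκ x.1.ht)

/-- The root is the greatest valid run. -/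
@[reducible]
def orderTopValidRun (hr : IsBot r.ht) : OrderTop (ValidRun r task halt) where
  top := ⟨r, isValid_root hr⟩
  le_top x := x.2.le_root

/-- The diagram of the last objects of the valid runs. -/
noncomputable def validFunctor (r : Run C κ.ord.ToType)
    (task : ∀ z : Run C κ.ord.ToType, Presieve ((lastFunctor C _).obj z))
    (halt : Run C κ.ord.ToType → Prop) : ValidRun r task halt ⥤ C where
  obj x := (lastFunctor C _).obj x.1
  map f := (lastFunctor C _).map (homOfLE (leOfHom f))
  map_id x := (lastFunctor C _).map_id x.1
  map_comp f g := by rw [← Functor.map_comp, homOfLE_comp]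

/-- The cotree of valid runs, provided that its branches are bounded. -/
noncomputable def tree (hκ : Cardinal.aleph0 ≤ κ) (hr : IsBot r.ht)
    (hb : ∀ b : Flag (ValidRun r task halt),
      ∃ i, ∀ x ∈ b, x.1.ht ≤ i) : CotreeIn κ C where
  T := ValidRun r task halt
  orderTop := orderTopValidRun hr
  isCotree := by
    let _ := orderTopValidRun (task := task) (halt := halt) hr
    exact isCotree hκ hr
  mk_branch_lt b := by
    obtain ⟨i, hi⟩ := hb b
    refine (Cardinal.mk_le_of_injective (f := fun x : b => (⟨x.1.1.ht, hi _ x.2⟩ : Set.Iic i))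
      ?_).trans_lt (Cardinal.mk_Iic_toType_ord_lt hκ i)
    intro x y hxy
    have hxy : x.1.1.ht = y.1.1.ht := congrArg Subtype.val hxy
    rcases b.le_or_le x.2 y.2 with h | h
    · exact Subtype.ext (Subtype.ext (eq_of_le_of_ht_eq h hxy))
    · exact Subtype.ext (Subtype.ext (eq_of_le_of_ht_eq h hxy.symm)).symm
  F := validFunctor r task halt
  continuous x hx := by
    have hx' : Order.IsPredLimit x.1 :=
      ⟨fun h => hx.1 fun y hy => h hy, fun y hy => hx.2 ⟨y, x.2.of_le hr hy.le⟩
        ((IsValid.covBy_iff hr _ _).2 hy)⟩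
    have hlim := x.2.isLimiting x.1 le_rfl hx'
    choose l hl hl' using fun s : Cone (restrictTo (validFunctor r task halt)
      (Set.Ioi x)) => hlim s.pt
        (fun z hz => s.π.app ⟨⟨z, x.2.of_le hr hz.le⟩, hz⟩)
        (fun z w hz hzw => s.w (j := ⟨⟨z, x.2.of_le hr hz.le⟩, hz⟩)
          (j' := ⟨⟨w, x.2.of_le hr (hz.le.trans hzw)⟩, hz.trans_le hzw⟩) (homOfLE hzw))
    exact ⟨{ lift := l
             fac := fun s j => hl s j.1.1 j.2
             uniq := fun s m hm => hl' s m fun z hz => hm ⟨⟨z, x.2.of_le hr hz.le⟩, hz⟩ }⟩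
  -- A minimal run that has not halted is one whose task is empty; it stays outside the leaves and
  -- its branch does not contribute.
  leaves := {x | IsMin x ∧ halt x.1}
  isMin_of_mem_leaves x hx := hx.1

end Tree

end Run

/-! ### Branches of the tree. -/

namespace Run

variable {C : Type u} [SmallCategory C] {κ : Cardinal.{u}} {r : Run C κ.ord.ToType}
  {task : ∀ z : Run C κ.ord.ToType, Presieve ((lastFunctor C _).obj z)}
  {halt : Run C κ.ord.ToType → Prop}

/-- A valid run can be prolonged by an arrow of its task. -/
theorem IsValid.exists_prolongation [NoMaxOrder κ.ord.ToType] {x : Run C κ.ord.ToType}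
    (hx : IsValid r task halt x) (hhalt : ¬ halt x) {Y : C} (f : Y ⟶ (lastFunctor C _).obj x)
    (hf : task x f) :
    ∃ (y : Run C κ.ord.ToType) (h : y ⋖ x) (_ : IsValid r task halt y)
      (e : (lastFunctor C _).obj y = Y),
      (lastFunctor C _).map (homOfLE h.le) = eqToHom e ≫ f := by
  obtain ⟨y, hy, hle, e, hmap⟩ := exists_extension (Order.succ x.ht)
    (fun i hi => x.res i (Order.lt_succ_iff.1 hi)) (fun _ _ => rfl)
    (fun i j hi hj h => le_of_le_of_ht_le (x.le_res (Order.lt_succ_iff.1 hj))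
      (x.le_res (Order.lt_succ_iff.1 hi)) h) Y
    (fun i hi => f ≫ (lastFunctor C _).map (homOfLE (x.le_res (Order.lt_succ_iff.1 hi))))
    (fun i j hi hj h => by rw [Category.assoc, ← Functor.map_comp, homOfLE_comp])
  have hyx : y ≤ x := hle x.ht (Order.lt_succ _)
  have hcov : y ⋖ x := covBy_of_le hyx hy
  have hmap' : (lastFunctor C _).map (homOfLE hyx) = eqToHom e ≫ f := by
    refine (hmap x.ht (Order.lt_succ _)).trans ?_
    congr 1
    exact (congrArg (f ≫ ·) ((lastFunctor C _).map_id x)).trans (Category.comp_id f)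
  subst e
  have hlt {z : Run C κ.ord.ToType} (h : y ≤ z) (h' : y ≠ z) : x ≤ z := by
    refine le_of_le_of_ht_le hyx h (Order.lt_succ_iff.1 ?_)
    rw [← hy]
    exact ht_lt (lt_of_le_of_ne h h')
  -- The only new node among the truncations of `y` is `y` itself, and its only cover is `x`; all
  -- else is inherited from `x`.
  have hcov' {z : Run C κ.ord.ToType} (h : y ⋖ z) : z = x :=
    (eq_of_le_of_ht_eq (hlt h.le h.ne) (Order.succ_injective
      (by rw [← hy, ht_eq_of_covBy h]))).symm
  refine ⟨y, hcov, ⟨hyx.trans hx.le_root, ?_, ?_, ?_⟩, rfl, hmap'⟩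
  · intro w z hw h
    by_cases h' : y = w
    · subst h'
      rwa [hcov' h]
    · exact hx.not_halt w z (hlt hw h') h
  · intro w z hw h
    by_cases h' : y = w
    · subst h'
      obtain rfl := hcov' h
      rw [hmap']
      simpa using hf
    · exact hx.mem_task w z (hlt hw h') h
  · intro w hw h
    by_cases h' : y = w
    · subst h'
      exact (h.2 _ hcov).elim
    · exact hx.isLimiting w (hlt hw h') h

theorem isBuiltFrom_tree [NoMaxOrder κ.ord.ToType]
    (hκ : Cardinal.aleph0 ≤ κ) (hr : IsBot r.ht)
    (hb : ∀ b : Flag (ValidRun r task halt), ∃ i, ∀ x ∈ b, x.1.ht ≤ i)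
    {B : ∀ X : C, Set (Presieve X)}
    (hB : ∀ x, IsValid r task halt x → ¬ halt x → task x ∈ B _) :
    (tree hκ hr hb).IsBuiltFrom B := by
  rintro ⟨x, hx⟩ hl
  -- A halted node has no valid run below it, so it is minimal and therefore a leaf.
  have hhalt : ¬ halt x := fun h => hl ⟨fun y hy => by
    by_contra hxy
    obtain ⟨z, hz, hzx⟩ := exists_covBy_of_lt (lt_of_le_not_ge hy hxy)
    exact y.2.not_halt z x hz hzx h, h⟩
  suffices ((tree hκ hr hb).predecessors ⟨x, hx⟩ : Presieve ((lastFunctor C _).obj x)) = task x from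
    (congrArg (· ∈ B ((lastFunctor C _).obj x)) this).mpr (hB x hx hhalt)
  funext Y
  ext f
  constructor
  · rintro ⟨⟨y, hy⟩⟩
    exact y.2.mem_task _ _ le_rfl ((IsValid.covBy_iff hr _ _).1 hy)
  · intro hf
    obtain ⟨y, h, hy, rfl, hmap⟩ := hx.exists_prolongation hhalt f hf
    obtain rfl : (lastFunctor C _).map (homOfLE h.le) = f :=
      hmap.trans (Category.id_comp f)
    exact Presieve.ofArrows.mk (⟨⟨y, hy⟩, (IsValid.covBy_iff hr _ _).2 h⟩ :
      {y : ValidRun r task halt // y ⋖ ⟨x, hx⟩})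

/-- A bounded branch of the tree of valid runs that has a limit has a least element. -/
theorem exists_isMin_of_isLimit (hr : IsBot r.ht) (b : Flag (ValidRun r task halt))
    (hb : ∃ i, ∀ x ∈ b, x.1.ht ≤ i)
    {c : Cone (restrictTo (validFunctor r task halt) (b : Set (ValidRun r task halt)))}
    (hc : IsLimit c) : ∃ x ∈ b, IsMin x := by
  by_contra! hmin
  have hup {x y : ValidRun r task halt} (hx : x ∈ b) (h : x ≤ y) : y ∈ b := by
    refine Flag.mem_iff_forall_le_or_ge.2 fun z hz => ?_
    rcases b.le_or_le hx hz with h' | h'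
    · rcases le_total y.1.ht z.1.ht with k | k
      · exact .inr (le_of_le_of_ht_le h' h k)
      · exact .inl (le_of_le_of_ht_le h h' k)
    · exact .inr (h'.trans h)
  have hlt {x : ValidRun r task halt} (hx : x ∈ b) : ∃ y ∈ b, y < x := by
    by_contra! h
    refine hmin x hx fun y hyx => ?_
    by_contra hxy
    refine h y (Flag.mem_iff_forall_le_or_ge.2 fun z hz => .inl ?_) (lt_of_le_not_ge hyx hxy)
    exact hyx.trans ((b.le_or_le hx hz).elim id fun h' =>
      (eq_of_le_of_not_lt h' (h z hz)).ge)
  obtain ⟨i₀, hi₀⟩ := hb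
  -- The supremum of the heights is not attained, as `b` has no least element. The limit cone then
  -- defines a run `x` of height `l` below all of `b`. It is valid, so maximality puts it in `b`, a
  -- contradiction.
  obtain ⟨l, hl, hlmin⟩ := WellFounded.has_min
    (wellFounded_lt : WellFounded fun a b : κ.ord.ToType => a < b)
    {i | ∀ x ∈ b, x.1.ht ≤ i} ⟨i₀, hi₀⟩
  have hl' {x : ValidRun r task halt} (hx : x ∈ b) : x.1.ht < l := by
    obtain ⟨y, hy, hyx⟩ := hlt hx
    exact (ht_lt hyx).trans_le (hl y hy)
  have hex (i) (hi : i < l) : ∃ x ∈ b, i < x.1.ht := by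
    by_contra! h
    exact hlmin i h hi
  choose t htb hti using hex
  let β (i) (hi : i < l) : ValidRun r task halt :=
    ⟨(t i hi).1.res i (hti i hi).le, (t i hi).2.of_le hr ((t i hi).1.le_res (hti i hi).le)⟩
  have hβ (i) (hi : i < l) : β i hi ∈ b := hup (htb i hi) ((t i hi).1.le_res (hti i hi).le)
  have hle {x y : ValidRun r task halt} (hx : x ∈ b) (hy : y ∈ b) (h : y.1.ht ≤ x.1.ht) :
      x ≤ y := by
    rcases b.le_or_le hx hy with k | k
    · exact k
    · exact (Subtype.ext (eq_of_le_of_ht_eq k (le_antisymm h k.1))).ge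
  obtain ⟨x, hx, hxβ, e, hmap⟩ := exists_extension l (fun i hi => (β i hi).1) (fun _ _ => rfl)
    (fun i j hi hj h => hle (hβ j hj) (hβ i hi) h) c.pt
    (fun i hi => c.π.app ⟨β i hi, hβ i hi⟩)
    (fun i j hi hj h => c.w (j := ⟨β j hj, hβ j hj⟩) (j' := ⟨β i hi, hβ i hi⟩)
      (homOfLE (hle (hβ j hj) (hβ i hi) h)))
  have hxb {y : ValidRun r task halt} (hy : y ∈ b) : x ≤ y.1 :=
    (hxβ _ (hl' hy)).trans (hle (hβ _ (hl' hy)) hy le_rfl)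
  have hxlt {y : Run C κ.ord.ToType} (h : x < y) : ∃ hy : IsValid r task halt y,
      (⟨y, hy⟩ : ValidRun r task halt) ∈ b := by
    have h' : y.ht < l := hx ▸ ht_lt h
    obtain ⟨i, hi, rfl⟩ : ∃ i, ∃ hi : i < l, (β i hi).1 = y := ⟨_, h', eq_of_le_of_ht_eq
      (le_of_le_of_ht_le (hxβ _ h') h.le le_rfl) rfl⟩
    exact ⟨_, hβ _ hi⟩
  have hcov {y : Run C κ.ord.ToType} (h : x ⋖ y) : False := by
    obtain ⟨hy, hyb⟩ := hxlt h.lt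
    obtain ⟨z, hz, hzy⟩ := hlt hyb
    exact h.2 (lt_of_le_of_ne (hxb hz) fun e => (hl' hz).ne (e ▸ hx)) hzy
  have hlim : IsLimiting x := by
    intro Y s hs
    let d : Cone (restrictTo (validFunctor r task halt) (b : Set (ValidRun r task halt))) :=
      { pt := Y
        π :=
          { app z := s z.1.1 (lt_of_le_of_ne (hxb z.2) fun e => (hl' z.2).ne (e ▸ hx))
            naturality z w f := (Category.id_comp _).trans (hs _ _ _ (leOfHom f)).symm } }
    have hmap' (z) (hz : x < z) : (lastFunctor C _).map (homOfLE hz.le) =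
        eqToHom e ≫ c.π.app ⟨⟨z, (hxlt hz).1⟩, (hxlt hz).2⟩ := by
      have h' : z.ht < l := hx ▸ ht_lt hz
      obtain ⟨i, hi, rfl⟩ : ∃ i, ∃ hi : i < l, (β i hi).1 = z := ⟨_, h', eq_of_le_of_ht_eq
        (le_of_le_of_ht_le (hxβ _ h') hz.le le_rfl) rfl⟩
      exact hmap _ hi
    refine ⟨hc.lift d ≫ eqToHom e.symm, fun z hz => ?_, fun m hm => ?_⟩
    · have he {W : C} (k : c.pt ⟶ W) :
          (hc.lift d ≫ eqToHom e.symm) ≫ eqToHom e ≫ k = hc.lift d ≫ k := by simp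
      exact (congrArg _ (hmap' z hz)).trans
        ((he _).trans (hc.fac d ⟨⟨z, (hxlt hz).1⟩, (hxlt hz).2⟩))
    · rw [← cancel_mono (eqToHom e), Category.assoc, eqToHom_trans, eqToHom_refl,
        Category.comp_id]
      refine hc.uniq d _ fun z => ?_
      have hz := lt_of_le_of_ne (hxb z.2) fun e => (hl' z.2).ne (e ▸ hx)
      rw [Category.assoc]
      exact (congrArg (m ≫ ·) (hmap' z.1.1 hz).symm).trans (hm _ hz)
  have htop : ∃ y, y ∈ b := by
    let _ := orderTopValidRun (task := task) (halt := halt) hr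
    exact ⟨⊤, b.top_mem⟩
  obtain ⟨y, hy⟩ := htop
  have hval : IsValid r task halt x := by
    refine ⟨(hxb hy).trans y.2.le_root, fun w z hw h => ?_, fun w z hw h => ?_, fun w hw h => ?_⟩
    · rcases eq_or_lt_of_le hw with rfl | hw
      · exact (hcov h).elim
      · exact (hxlt hw).1.not_halt w z le_rfl h
    · rcases eq_or_lt_of_le hw with rfl | hw
      · exact (hcov h).elim
      · exact (hxlt hw).1.mem_task w z le_rfl h
    · rcases eq_or_lt_of_le hw with rfl | hw
      · exact hlim
      · exact (hxlt hw).1.isLimiting w le_rfl h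
  have hxmem : (⟨x, hval⟩ : ValidRun r task halt) ∈ b :=
    Flag.mem_iff_forall_le_or_ge.2 fun z hz => .inl (hxb hz)
  exact (hl' hxmem).ne hx

/-- The cochain of runs given by a coherent family. -/
noncomputable def cochain (β : κ.ord.ToType → Run C κ.ord.ToType) (hβ : Antitone β) :
    κ.ord.ToTypeᵒᵖ ⥤ Run C κ.ord.ToType where
  obj i := β i.unop
  map f := homOfLE (hβ (leOfHom f.unop))

/-- If the presieve `R` is scheduled for stage `j`, the step from `j` to its successor lies in the
task there, which refines the pullback of `R`. -/
theorem isGeneric_cochain [NoMaxOrder κ.ord.ToType] {B : ∀ X : C, Set (Presieve X)}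
    (htask : ∀ (y : Run C κ.ord.ToType), ∀ R ∈ B ((lastFunctor C _).obj y), ∃ j, y.ht ≤ j ∧
        ∀ (z : Run C κ.ord.ToType) (h : z ≤ y), z.ht = j →
          task z ≤ ((Sieve.generate R).pullback ((lastFunctor C _).map (homOfLE h))).arrows)
    (β : κ.ord.ToType → Run C κ.ord.ToType) (hβ : Antitone β) (hht : ∀ i, (β i).ht = i)
    (hval : ∀ i, IsValid r task halt (β i)) :
    IsGeneric B (cochain β hβ ⋙ lastFunctor C _) := by
  intro i R hR
  obtain ⟨j, hij, hj⟩ := htask (β i) R hR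
  rw [hht] at hij
  have hcov : β (Order.succ j) ⋖ β j :=
    covBy_of_le (hβ (Order.le_succ j)) (by rw [hht, hht])
  have h := hj (β j) (hβ hij) (hht j) _ _ ((hval _).mem_task _ _ le_rfl hcov)
  refine ⟨Order.succ j, hij.trans (Order.le_succ j), ?_⟩
  exact (congrArg (fun k => Sieve.generate R k) ((lastFunctor C _).map_comp
    (homOfLE hcov.le) (homOfLE (hβ hij)))).mpr h

/-- The set of heights of a branch of the tree of valid runs is bounded, unless there is a
generic cochain that avoids `halt`. -/
theorem exists_cochain_of_unbounded [NoMaxOrder κ.ord.ToType] (hr : IsBot r.ht)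
    (b : Flag (ValidRun r task halt)) (hb : ¬ ∃ i, ∀ x ∈ b, x.1.ht ≤ i) :
    ∃ β : κ.ord.ToType → Run C κ.ord.ToType, Antitone β ∧ (∀ i, (β i).ht = i) ∧
      (∀ i, IsValid r task halt (β i)) ∧ ∀ i, ¬ halt (β i) := by
  push Not at hb
  choose t htb hti using hb
  have hval (i) : IsValid r task halt ((t i).1.res i (hti i).le) :=
    (t i).2.of_le hr ((t i).1.le_res _)
  have hanti : Antitone fun i => (t i).1.res i (hti i).le := by
    intro i j hij
    rcases b.le_or_le (htb i) (htb j) with h | h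
    · exact le_of_le_of_ht_le (le_trans (show (t i).1 ≤ (t j).1 from h) ((t j).1.le_res (hti j).le))
        ((t i).1.le_res (hti i).le) hij
    · exact le_of_le_of_ht_le ((t j).1.le_res (hti j).le)
        (le_trans (show (t j).1 ≤ (t i).1 from h) ((t i).1.le_res (hti i).le)) hij
  -- No stage has halted because the next one is still a valid run.
  exact ⟨_, hanti, fun _ => rfl, hval, fun i => (hval _).not_halt _ _ le_rfl
    (covBy_of_le (hanti (Order.le_succ i)) rfl)⟩

end Run

open GrothendieckTopology.Point in
theorem exists_fac_of_fiber_map_eq {κ : Cardinal.{u}} [Fact κ.IsRegular] {C : Type u}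
    [SmallCategory C] {p : κ.ord.ToTypeᵒᵖ ⥤ C} {X Y : C} (g : Y ⟶ X) {i : κ.ord.ToType}
    (f : p.obj (.op i) ⟶ X) (y : (ofIsCofiltered.fiber.{u} p).obj Y)
    (hy : (ofIsCofiltered.fiber.{u} p).map g y = ofIsCofiltered.fiberMk f) :
    ∃ (j : κ.ord.ToType) (h : i ≤ j) (b : p.obj (.op j) ⟶ Y),
      b ≫ g = p.map (homOfLE h).op ≫ f := by
  obtain ⟨⟨j⟩, a, rfl⟩ := ofIsCofiltered.fiberMk_jointly_surjective y
  rw [ofIsCofiltered.fiber_map_fiberMk,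
    ← ofIsCofiltered.fiberMk_map_comp (p := p) (homOfLE (le_max_right i j)).op,
    ← ofIsCofiltered.fiberMk_map_comp (p := p) (homOfLE (le_max_left i j)).op] at hy
  obtain ⟨⟨k⟩, h, hk⟩ := ofIsCofiltered.exists_of_fiberMk_eq_fiberMk hy
  refine ⟨k, (le_max_left i j).trans (leOfHom h.unop), 
    p.map h ≫ p.map (homOfLE (le_max_right i j)).op ≫ a, ?_⟩
  rw [Category.assoc, Category.assoc, hk, ← Category.assoc, ← p.map_comp]
  rfl

/-! ### Enough `κ`-points. -/

open Run

theorem theorem4p1 (κ : Cardinal.{u}) (hκ : κ.IsRegular)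
    (C : Type u) [SmallCategory C] (hC : HasCochainLimits κ C)
    (J : GrothendieckTopology C) (hJ : IsWoven κ J) :
    HasEnoughKappaPoints κ J := by
  obtain ⟨B, hcard⟩ := hJ
  have : Fact κ.IsRegular := ⟨hκ⟩
  have hω := hκ.aleph0_le
  have : NoMaxOrder κ.ord.ToType := Cardinal.noMaxOrder hω
  obtain ⟨i₀, hi₀⟩ : ∃ i : κ.ord.ToType, IsBot i := by
    have : Nonempty κ.ord.ToType := by
      rw [← Cardinal.mk_ne_zero_iff, Cardinal.mk_ord_toType]
      exact hκ.ne_zero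
    obtain ⟨i, -, hi⟩ := WellFounded.has_min
      (wellFounded_lt : WellFounded fun a b : κ.ord.ToType => a < b) Set.univ Set.univ_nonempty
    exact ⟨i, fun j => not_lt.1 (hi j trivial)⟩
  let q (p : {p : κ.ord.ToTypeᵒᵖ ⥤ C // IsGeneric B.presieves p}) :
    GrothendieckTopology.Point.{u} J := p.2.point hC
  -- Conservativity is tested on sieves: one along which all points of the family lift elements must
  -- be covering.
  refine ⟨ObjectProperty.ofObj q, inferInstance, .mk' fun X S hS => ?_, ?_⟩
  · have hgen (p : κ.ord.ToTypeᵒᵖ ⥤ C) (hp : IsGeneric B.presieves p) (i : κ.ord.ToType)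
        (f : p.obj (.op i) ⟶ X) : ∃ (j : κ.ord.ToType) (h : i ≤ j),
          S (p.map (homOfLE h).op ≫ f) := by
      obtain ⟨Y, g, hg, y, hy⟩ := hS ⟨q ⟨p, hp⟩, ObjectProperty.ofObj_apply _ _⟩
        (GrothendieckTopology.Point.ofIsCofiltered.fiberMk.{u} f)
      obtain ⟨j, h, b, hb⟩ := exists_fac_of_fiber_map_eq g f y hy
      exact ⟨j, h, hb ▸ S.downward_closed hg b⟩
    obtain ⟨task, htask, hgeneric⟩ := exists_tasks hω B.presieves B.pullback hcard
    let r : Run C κ.ord.ToType := ⟨i₀, (Functor.const _).obj (.op X)⟩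
    have hr : IsBot r.ht := hi₀
    let halt (x : Run C κ.ord.ToType) : Prop :=
      ∃ h : x ≤ r, S ((lastFunctor C _).map (homOfLE h))
    have hb (b : Flag (ValidRun r task halt)) : ∃ i, ∀ x ∈ b, x.1.ht ≤ i := by
      by_contra hb
      obtain ⟨β, hβ, hht, hval, hhalt⟩ := exists_cochain_of_unbounded hr b hb
      obtain ⟨j, h, hj⟩ := hgen _ (isGeneric_cochain hgeneric β hβ hht hval) i₀
        ((lastFunctor C _).map (homOfLE (hval i₀).le_root))
      refine hhalt j ⟨(hval j).le_root, ?_⟩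
      exact (congrArg (fun k => S k) ((lastFunctor C _).map_comp
        (homOfLE (hβ h)) (homOfLE (hval i₀).le_root))).mpr hj
    -- With no presieve over the last object of `x`, the constant cochain there is vacuously
    -- generic. Its point forces the map to `X` into `S`, so `x` has halted.
    have hne (x) (hx : IsValid r task halt x) (hs : ¬ halt x) :
        (B.presieves ((lastFunctor C _).obj x)).Nonempty := by
      by_contra hempty
      rw [Set.not_nonempty_iff_eq_empty] at hempty
      obtain ⟨j, h, hj⟩ := hgen ((Functor.const _).obj ((lastFunctor C _).obj x))
        (fun i R hR => (Set.eq_empty_iff_forall_notMem.1 hempty R hR).elim) i₀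
        ((lastFunctor C _).map (homOfLE hx.le_root))
      exact hs ⟨hx.le_root, (congrArg (fun k => S k) (Category.id_comp _)).mp hj⟩
    refine J.superset_covering ?_ (B.multicomposite_mem (tree hω hr hb)
      (isBuiltFrom_tree hω hr hb fun x hx hs => htask x (hne x hx hs)))
    refine (Sieve.generate_le_iff (X := X) _ S).2 ?_
    rintro Y _ ⟨b, hleaf, c, hc⟩
    obtain ⟨x, hx, hmin⟩ := exists_isMin_of_isLimit hr b (hb b) hc
    obtain ⟨-, h, hS'⟩ := hleaf x hx hmin
    -- The projection of the branch to the root factors through its leaf, whose map to `X` is in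
    -- `S`.
    have := S.downward_closed hS' (c.π.app ⟨x, hx⟩)
    exact (congrArg (fun k => S k)
      (c.w (j := ⟨x, hx⟩) (j' := ⟨_, b.top_mem⟩) (homOfLE x.2.le_root))).mp this
  · rintro _ ⟨p⟩
    exact isKappaPoint_of_fiber_eq p.1 _ rfl
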